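/- Let $n\ge 2$ and let $\mathbf{H}^n$ be hyperbolic $n$-space of curvature $-1$ with distance $d$. Let $\Pi$ be a hyperbolic hyperplane (for $n=2$: a line), let $r>0$, and let $H=\{X : d(X,\Pi)=r\}$ be the hypersphere (for $n=2$: the hypercycle) with base $\Pi$ and distance $r$. Its two branches $H_1$ and $H_2$ are the parts of $H$ that lie in the two open half-spaces bounded by $\Pi$. Let $P$ be a point of $\mathbf{H}^n$. Then there is a constant $c$, depending only on $P$, $H_1$ and $H_2$, such that: (i) If a hyperbolic line through $P$ intersects $H_1$ at two distinct points $A$ and $B$, then $$\tanh\left(\frac{d(P,A)}{2}\right)\cdot\tanh\left(\frac{d(P,B)}{2}\right)=c.$$ (ii) If a hyperbolic line through $P$ intersects $H_1$ at $A$ and $H_2$ at $B$, where $B\neq P$ (so that the hyperbolic cotangent is defined), then $$\tanh\left(\frac{d(P,A)}{2}\right)\cdot\coth\left(\frac{d(P,B)}{2}\right)=c.$$ In particular, each of the two products is independent of the choice of the secant line through $P$, and the product in (ii) equals the product in (i) whenever some line through $P$ meets $H_1$ at two distinct points. -/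

import Mathlib

/-- The Lorentzian bilinear form `x₁ y₁ + ⋯ + xₙ yₙ - x₀ y₀` on `ℝ^(n+1)`. -/
def lorentz {n : ℕ} (x y : Fin (n + 1) → ℝ) : ℝ :=
  (∑ i : Fin n, x i.succ * y i.succ) - x 0 * y 0

/-- Hyperbolic `n`-space `H^n` (curvature `-1`), in the hyperboloid model: the upper sheet of
`⟨x, x⟩ = -1`. -/
def HypSpace (n : ℕ) : Type :=
  {x : Fin (n + 1) → ℝ // lorentz x x = -1 ∧ 0 < x 0}

namespace HypSpace

/-- The hyperbolic distance: `cosh d(x, y) = -⟨x, y⟩`. -/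
noncomputable def hdist {n : ℕ} (x y : HypSpace n) : ℝ :=
  Real.arcosh (-lorentz x.1 y.1)

/-- A hyperbolic line: a nonempty intersection of `H^n` with a two-dimensional linear subspace of
`ℝ^(n+1)`. -/
def IsLine {n : ℕ} (L : Set (HypSpace n)) : Prop :=
  L.Nonempty ∧ ∃ V : Submodule ℝ (Fin (n + 1) → ℝ),
    Module.finrank ℝ V = 2 ∧ L = {x : HypSpace n | x.1 ∈ V}

/-- The hyperbolic hyperplane with normal vector `u`. The hyperplanes of `H^n` are these sets, for
the space-like vectors `u` (those with `0 < ⟨u, u⟩`). For `n = 2` they are the lines. -/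
def hyperplane {n : ℕ} (u : Fin (n + 1) → ℝ) : Set (HypSpace n) :=
  {x | lorentz x.1 u = 0}

/-- The distance from a point to a (nonempty) set. -/
noncomputable def distToSet {n : ℕ} (x : HypSpace n) (S : Set (HypSpace n)) : ℝ :=
  ⨅ y : S, hdist x y.1

/-- The hypersphere (for `n = 2`, the hypercycle) of distance `r > 0` with base hyperplane
`hyperplane u`: all the points at distance `r` from that hyperplane. -/
def hypersphere {n : ℕ} (u : Fin (n + 1) → ℝ) (r : ℝ) : Set (HypSpace n) :=
  {x | distToSet x (hyperplane u) = r}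

/-- The branch of the hypersphere on the side of its base hyperplane to which `u` points. Replacing
`u` by `-u` leaves the hypersphere as it is and exchanges its two branches. -/
def posBranch {n : ℕ} (u : Fin (n + 1) → ℝ) (r : ℝ) : Set (HypSpace n) :=
  {x | x ∈ hypersphere u r ∧ 0 < lorentz x.1 u}

/-- The branch of the hypersphere on the other side of its base hyperplane. -/
def negBranch {n : ℕ} (u : Fin (n + 1) → ℝ) (r : ℝ) : Set (HypSpace n) :=
  {x | x ∈ hypersphere u r ∧ lorentz x.1 u < 0}

end HypSpace

/-- The hyperbolic cotangent, for `t ≠ 0`. -/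
noncomputable def hcoth (t : ℝ) : ℝ := Real.cosh t / Real.sinh t

/-! The branches are the level sets `⟨X, u⟩ = ±k`, with `k = √⟨u, u⟩ sinh r`. On a line `X = cosh t
P + sinh t v` this reads `p cosh t + q sinh t = ±k`, where `p = ⟨P, u⟩`, and only `q = ⟨v, u⟩`
depends on the line. For `+k`, `x = tanh (t/2)` is a root of `(p + k) x² + 2 q x + (p - k)`, whose
product of roots `(p - k) / (p + k)` does not involve `q`. Changing `k` to `-k` reverses the
coefficients, so the second branch contributes reciprocals of roots: hence `coth`. Distances are
`|t|`, hence the absolute values in the constant. -/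

theorem lorentz_comm {n : ℕ} (x y : Fin (n + 1) → ℝ) : lorentz x y = lorentz y x := by
  simp only [lorentz, mul_comm]

theorem lorentz_add_left {n : ℕ} (x y z : Fin (n + 1) → ℝ) :
    lorentz (x + y) z = lorentz x z + lorentz y z := by
  simp only [lorentz, Pi.add_apply, add_mul, Finset.sum_add_distrib]
  ring

theorem lorentz_smul_left {n : ℕ} (a : ℝ) (x z : Fin (n + 1) → ℝ) :
    lorentz (a • x) z = a * lorentz x z := by
  simp only [lorentz, Pi.smul_apply, smul_eq_mul, mul_sub, Finset.mul_sum, mul_assoc]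

theorem lorentz_add_right {n : ℕ} (x y z : Fin (n + 1) → ℝ) :
    lorentz x (y + z) = lorentz x y + lorentz x z := by
  rw [lorentz_comm, lorentz_add_left, lorentz_comm y, lorentz_comm z]

theorem lorentz_smul_right {n : ℕ} (a : ℝ) (x z : Fin (n + 1) → ℝ) :
    lorentz x (a • z) = a * lorentz x z := by
  rw [lorentz_comm, lorentz_smul_left, lorentz_comm]

/-- The Cauchy–Schwarz inequality for the space-like coordinates. -/
theorem sq_lorentz_add_le {n : ℕ} (x y : Fin (n + 1) → ℝ) :
    (lorentz x y + x 0 * y 0) ^ 2 ≤ (lorentz x x + x 0 ^ 2) * (lorentz y y + y 0 ^ 2) := by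
  have h := Finset.sum_mul_sq_le_sq_mul_sq Finset.univ
    (fun i : Fin n => x i.succ) (fun i : Fin n => y i.succ)
  simpa only [lorentz, sub_add_cancel, ← sq] using h

theorem zero_le_lorentz_self_add {n : ℕ} (x : Fin (n + 1) → ℝ) :
    0 ≤ lorentz x x + x 0 ^ 2 := by
  simp only [lorentz, ← sq, sub_add_cancel]
  positivity

theorem eq_zero_of_lorentz_self_nonpos {n : ℕ} {x : Fin (n + 1) → ℝ} (h0 : x 0 = 0)
    (h : lorentz x x ≤ 0) : x = 0 := by
  have hs : ∑ i : Fin n, x i.succ ^ 2 ≤ 0 := by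
    simpa [lorentz, h0, ← sq] using h
  have hs' := le_antisymm hs (Finset.sum_nonneg fun i _ => sq_nonneg (x i.succ))
  rw [Finset.sum_eq_zero_iff_of_nonneg fun i _ => sq_nonneg (x i.succ)] at hs'
  funext i
  refine Fin.cases h0 (fun j => ?_) i
  simpa using hs' j (Finset.mem_univ j)

/-! ### Half-angle substitution and the product of roots -/

theorem cosh_sinh_mul_one_sub_tanh_half_sq (t : ℝ) :
    Real.cosh t * (1 - Real.tanh (t / 2) ^ 2) = 1 + Real.tanh (t / 2) ^ 2 ∧
      Real.sinh t * (1 - Real.tanh (t / 2) ^ 2) = 2 * Real.tanh (t / 2) := by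
  have hc := (Real.cosh_pos (t / 2)).ne'
  have h1 : Real.cosh t = Real.cosh (t / 2) ^ 2 + Real.sinh (t / 2) ^ 2 := by
    rw [← Real.cosh_two_mul]; ring_nf
  have h2 : Real.sinh t = 2 * Real.sinh (t / 2) * Real.cosh (t / 2) := by
    rw [← Real.sinh_two_mul]; ring_nf
  have h3 := Real.cosh_sq (t / 2)
  rw [h1, h2, Real.tanh_eq_sinh_div_cosh]
  constructor
  · field_simp
    rw [h3]; ring
  · field_simp
    rw [h3]; ring

theorem tanh_half_abs (t : ℝ) : Real.tanh (|t| / 2) = |Real.tanh (t / 2)| := by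
  have h2 : |t| / 2 = |t / 2| := by rw [abs_div, abs_two]
  rw [h2, Real.tanh_eq_sinh_div_cosh, Real.tanh_eq_sinh_div_cosh,
    abs_div (Real.sinh _), Real.abs_sinh, Real.cosh_abs, abs_of_pos (Real.cosh_pos (t / 2))]

theorem hcoth_eq_inv_tanh (t : ℝ) : hcoth t = (Real.tanh t)⁻¹ := by
  rw [hcoth, Real.tanh_eq_sinh_div_cosh, inv_div]

/-- The half-angle form of `p cosh t + q sinh t = k`. -/
theorem quadratic_tanh_half {p q k t : ℝ} (h : p * Real.cosh t + q * Real.sinh t = k) :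
    (p + k) * Real.tanh (t / 2) ^ 2 + 2 * q * Real.tanh (t / 2) + (p - k) = 0 := by
  obtain ⟨h1, h2⟩ := cosh_sinh_mul_one_sub_tanh_half_sq t
  linear_combination (1 - Real.tanh (t / 2) ^ 2) * h - p * h1 - q * h2

/-- Vieta without division, so that `a = 0` is not excluded beforehand. -/
theorem mul_eq_of_distinct_roots {a b c x y : ℝ} (hx : a * x ^ 2 + b * x + c = 0)
    (hy : a * y ^ 2 + b * y + c = 0) (hxy : x ≠ y) : a * (x * y) = c := by
  have h : a * (x + y) + b = 0 := by
    apply mul_left_cancel₀ (sub_ne_zero.2 hxy)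
    linear_combination hx - hy
  linear_combination x * h - hx

theorem abs_eq_div_abs_of_mul_eq {a x c : ℝ} (ha : a ≠ 0) (h : a * x = c) :
    |x| = |c| / |a| := by
  rw [← abs_div, ← h, mul_div_cancel_left₀ _ ha]

theorem tanh_half_mul_tanh_half {p q k s t : ℝ} (hk : 0 < k)
    (hs : p * Real.cosh s + q * Real.sinh s = k) (ht : p * Real.cosh t + q * Real.sinh t = k)
    (hst : s ≠ t) :
    Real.tanh (|s| / 2) * Real.tanh (|t| / 2) = |p - k| / |p + k| := by
  have hne : Real.tanh (s / 2) ≠ Real.tanh (t / 2) := fun h =>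
    hst (by have := Real.tanh_injective h; linarith)
  have h := mul_eq_of_distinct_roots (quadratic_tanh_half hs) (quadratic_tanh_half ht) hne
  -- If `p + k = 0`, the product formula forces `p - k = 0` too, so `k = 0`.
  have hpk : p + k ≠ 0 := by
    intro h0
    rw [h0, zero_mul] at h
    linarith
  rw [tanh_half_abs, tanh_half_abs, ← abs_mul, abs_eq_div_abs_of_mul_eq hpk h]

theorem tanh_half_mul_hcoth_half {p q k s t : ℝ} (hk : 0 < k)
    (hs : p * Real.cosh s + q * Real.sinh s = k) (ht : p * Real.cosh t + q * Real.sinh t = -k)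
    (ht0 : t ≠ 0) :
    Real.tanh (|s| / 2) * hcoth (|t| / 2) = |p - k| / |p + k| := by
  have h1 := quadratic_tanh_half hs
  have h2 := quadratic_tanh_half ht
  have hs1 := Real.abs_tanh_lt_one (s / 2)
  have ht1 := Real.abs_tanh_lt_one (t / 2)
  have hy : Real.tanh (t / 2) ≠ 0 := by
    intro h
    rw [← Real.tanh_zero] at h
    exact ht0 (by have := Real.tanh_injective h; linarith)
  rw [hcoth_eq_inv_tanh, tanh_half_abs, tanh_half_abs, ← abs_inv, ← abs_mul]
  set x := Real.tanh (s / 2)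
  set y := Real.tanh (t / 2)
  have h3 : (p + k) * y⁻¹ ^ 2 + 2 * q * y⁻¹ + (p - k) = 0 := by
    field_simp
    linear_combination h2
  -- The two roots differ because `|x| < 1 < |y⁻¹|`.
  have hne : x ≠ y⁻¹ := by
    intro h
    rw [h, abs_inv] at hs1
    exact absurd hs1 (not_lt.2 ((one_le_inv₀ (abs_pos.2 hy)).2 ht1.le))
  have h := mul_eq_of_distinct_roots h1 h3 hne
  have hpk : p + k ≠ 0 := by
    intro h0
    rw [h0, zero_mul] at h
    linarith
  exact abs_eq_div_abs_of_mul_eq hpk h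

/-! ### Geometry of the hyperboloid -/

namespace HypSpace

variable {n : ℕ}

theorem one_le_zero_sq (x : HypSpace n) : 1 ≤ x.1 0 ^ 2 := by
  have := zero_le_lorentz_self_add x.1
  rw [x.2.1] at this
  linarith

theorem one_le_neg_lorentz (x y : HypSpace n) : 1 ≤ -lorentz x.1 y.1 := by
  have h := sq_lorentz_add_le x.1 y.1
  rw [x.2.1, y.2.1] at h
  have hx : 1 ≤ x.1 0 := (one_le_sq_iff₀ x.2.2.le).1 x.one_le_zero_sq
  have hy : 1 ≤ y.1 0 := (one_le_sq_iff₀ y.2.2.le).1 y.one_le_zero_sq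
  -- `(ab - 1)² - (a² - 1)(b² - 1) = (a - b)²`.
  have h1 : (lorentz x.1 y.1 + x.1 0 * y.1 0) ^ 2 ≤ (x.1 0 * y.1 0 - 1) ^ 2 := by
    nlinarith [sq_nonneg (x.1 0 - y.1 0)]
  have h2 := abs_le_of_sq_le_sq h1 (by nlinarith)
  linarith [(abs_le.1 h2).2]

/-- The orthogonal complement of a point of `H^n` is space-like. -/
theorem lorentz_self_pos_of_orthogonal (P : HypSpace n) {x : Fin (n + 1) → ℝ}
    (h : lorentz x P.1 = 0) (hx : x ≠ 0) : 0 < lorentz x x := by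
  by_contra! hn
  have h1 := sq_lorentz_add_le x P.1
  rw [h, P.2.1] at h1
  have h2 := P.one_le_zero_sq
  have h3 : x 0 ^ 2 ≤ 0 := by nlinarith
  exact hx (eq_zero_of_lorentz_self_nonpos (by simpa using le_antisymm h3 (sq_nonneg _)) hn)

/-- Places the normalized projection of a point on the upper sheet. -/
theorem zero_coord_pos_of_lorentz_neg (P : HypSpace n) {m : Fin (n + 1) → ℝ}
    (hm : lorentz m m < 0) (h : lorentz P.1 m < 0) : 0 < m 0 := by
  by_contra! h0
  have h1 := sq_lorentz_add_le P.1 m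
  rw [P.2.1] at h1
  have h2 := P.one_le_zero_sq
  have h3 := zero_le_lorentz_self_add m
  have h4 : P.1 0 * m 0 ≤ 0 := mul_nonpos_of_nonneg_of_nonpos P.2.2.le h0
  have h5 : (P.1 0 * m 0) ^ 2 ≤ (lorentz P.1 m + P.1 0 * m 0) ^ 2 := by nlinarith
  nlinarith

/-- The least distance from a point to a hyperplane, attained at its orthogonal projection. -/
theorem isLeast_hdist_hyperplane {u : Fin (n + 1) → ℝ} (hu : 0 < lorentz u u) (x : HypSpace n) :
    IsLeast (Set.range fun y : hyperplane u => hdist x y.1)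
      (Real.arcosh (√(1 + lorentz x.1 u ^ 2 / lorentz u u))) := by
  set U := lorentz u u with hU
  set h := lorentz x.1 u with hh
  set w := √(1 + h ^ 2 / U) with hw
  have hpos : 0 < 1 + h ^ 2 / U := by positivity
  have hw0 : 0 < w := Real.sqrt_pos.2 hpos
  have hw2 : w ^ 2 = 1 + h ^ 2 / U := Real.sq_sqrt hpos.le
  -- The component of `x` orthogonal to `u`; scaled by `w⁻¹` it is the foot of the perpendicular.
  set m : Fin (n + 1) → ℝ := x.1 + (-(h / U)) • u with hm
  have hmy (y : Fin (n + 1) → ℝ) : lorentz m y = lorentz x.1 y - h / U * lorentz u y := by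
    rw [hm, lorentz_add_left, lorentz_smul_left]; ring
  have hmu : lorentz m u = 0 := by
    rw [hmy, ← hU, ← hh]; field_simp; ring
  have hxm : lorentz x.1 m = -w ^ 2 := by
    rw [lorentz_comm, hmy, x.2.1, lorentz_comm u, ← hh, hw2]; ring
  have hmm : lorentz m m = -w ^ 2 := by
    rw [hmy, hxm, lorentz_comm u, hmu]; ring
  have hm0 := zero_coord_pos_of_lorentz_neg x (hmm.trans_lt (by nlinarith))
    (hxm.trans_lt (by nlinarith))
  have hy1 : lorentz (w⁻¹ • m) (w⁻¹ • m) = -1 := by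
    rw [lorentz_smul_left, lorentz_smul_right, hmm]; field_simp
  have hy2 : 0 < (w⁻¹ • m) 0 := mul_pos (inv_pos.2 hw0) hm0
  let y : HypSpace n := ⟨w⁻¹ • m, hy1, hy2⟩
  have hyu : lorentz y.1 u = 0 := by
    change lorentz (w⁻¹ • m) u = 0
    rw [lorentz_smul_left, hmu, mul_zero]
  constructor
  · refine ⟨⟨y, hyu⟩, ?_⟩
    change Real.arcosh (-lorentz x.1 (w⁻¹ • m)) = _
    rw [lorentz_smul_right, hxm]
    congr 1
    field_simp
  · rintro _ ⟨⟨z, hz⟩, rfl⟩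
    change lorentz z.1 u = 0 at hz
    -- Since `z` is orthogonal to `u`, `⟨m, z⟩ = ⟨x, z⟩`, so this bound for the foot becomes `w ≤
    -- cosh d(x, z)`.
    have h1 := one_le_neg_lorentz y z
    change 1 ≤ -lorentz (w⁻¹ • m) z.1 at h1
    rw [lorentz_smul_left, hmy, lorentz_comm u, hz, mul_zero, sub_zero] at h1
    have h2 : w ≤ -lorentz x.1 z.1 := by
      have := mul_le_mul_of_nonneg_left h1 hw0.le
      field_simp at this
      linarith
    exact (Real.arcosh_le_arcosh hw0 (by linarith [one_le_neg_lorentz x z])).2 h2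

theorem distToSet_hyperplane {u : Fin (n + 1) → ℝ} (hu : 0 < lorentz u u) (x : HypSpace n) :
    distToSet x (hyperplane u) = Real.arcosh (√(1 + lorentz x.1 u ^ 2 / lorentz u u)) :=
  (isLeast_hdist_hyperplane hu x).csInf_eq

theorem sq_lorentz_of_mem_hypersphere {u : Fin (n + 1) → ℝ} (hu : 0 < lorentz u u) {r : ℝ}
    {x : HypSpace n} (hx : x ∈ hypersphere u r) :
    lorentz x.1 u ^ 2 = (√(lorentz u u) * Real.sinh r) ^ 2 := by
  have hd : distToSet x (hyperplane u) = r := hx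
  rw [distToSet_hyperplane hu] at hd
  have hq : 0 ≤ lorentz x.1 u ^ 2 / lorentz u u := by positivity
  have hc : Real.cosh r ^ 2 = 1 + lorentz x.1 u ^ 2 / lorentz u u := by
    rw [← hd, Real.cosh_arcosh (Real.one_le_sqrt.2 (by linarith)), Real.sq_sqrt (by linarith)]
  rw [Real.cosh_sq] at hc
  have hs : Real.sinh r ^ 2 = lorentz x.1 u ^ 2 / lorentz u u := by linarith
  rw [mul_pow, Real.sq_sqrt hu.le, hs]
  field_simp

theorem lorentz_of_mem_posBranch {u : Fin (n + 1) → ℝ} (hu : 0 < lorentz u u) {r : ℝ}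
    (hr : 0 < r) {x : HypSpace n} (hx : x ∈ posBranch u r) :
    lorentz x.1 u = √(lorentz u u) * Real.sinh r := by
  have := Real.sinh_pos_iff.2 hr
  exact (pow_left_inj₀ hx.2.le (by positivity) two_ne_zero).1 (sq_lorentz_of_mem_hypersphere hu hx.1)

theorem lorentz_of_mem_negBranch {u : Fin (n + 1) → ℝ} (hu : 0 < lorentz u u) {r : ℝ}
    (hr : 0 < r) {x : HypSpace n} (hx : x ∈ negBranch u r) :
    lorentz x.1 u = -(√(lorentz u u) * Real.sinh r) := by
  have := Real.sinh_pos_iff.2 hr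
  rcases sq_eq_sq_iff_eq_or_eq_neg.1 (sq_lorentz_of_mem_hypersphere hu hx.1) with h | h
  · have h0 : lorentz x.1 u < 0 := hx.2
    rw [h] at h0
    exact absurd h0 (not_lt.2 (by positivity))
  · exact h

/-- The parametrization of a line through `P` by the signed distance from `P`. -/
theorem IsLine.exists_param {L : Set (HypSpace n)} (hL : IsLine L) {P : HypSpace n} (hP : P ∈ L) :
    ∃ v : Fin (n + 1) → ℝ, ∀ X ∈ L, ∃ t : ℝ,
      X.1 = Real.cosh t • P.1 + Real.sinh t • v ∧ hdist P X = |t| := by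
  obtain ⟨-, V, hV, rfl⟩ := hL
  have hP : P.1 ∈ V := hP
  have hP0 : P.1 ≠ 0 := fun h => by simpa [h] using P.2.2
  obtain ⟨w, hwV, hw⟩ : ∃ w ∈ V, w ∉ Submodule.span ℝ {P.1} := by
    by_contra! hc
    have h1 := Submodule.finrank_mono (show V ≤ Submodule.span ℝ {P.1} from hc)
    rw [hV, finrank_span_singleton hP0] at h1
    omega
  -- Gram–Schmidt; the sign is `+` because `⟨P, P⟩ = -1`.
  set v' := w + lorentz w P.1 • P.1 with hv'
  have hv'V : v' ∈ V := V.add_mem hwV (V.smul_mem _ hP)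
  have hv'P : lorentz v' P.1 = 0 := by
    rw [hv', lorentz_add_left, lorentz_smul_left, P.2.1]; ring
  have hv'0 : v' ≠ 0 := fun h => hw <| Submodule.mem_span_singleton.2
    ⟨-lorentz w P.1, by rw [neg_smul]; exact (eq_neg_of_add_eq_zero_left h).symm⟩
  have hpos := lorentz_self_pos_of_orthogonal P hv'P hv'0
  set v := (√(lorentz v' v'))⁻¹ • v' with hv
  have hvV : v ∈ V := V.smul_mem _ hv'V
  have hvP : lorentz v P.1 = 0 := by rw [hv, lorentz_smul_left, hv'P, mul_zero]
  have hvv : lorentz v v = 1 := by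
    rw [hv, lorentz_smul_left, lorentz_smul_right, ← mul_assoc, ← mul_inv,
      Real.mul_self_sqrt hpos.le, inv_mul_cancel₀ hpos.ne']
  have hind : LinearIndependent ℝ ![P.1, v] := by
    rw [LinearIndependent.pair_iff]
    intro a b hab
    have h1 : lorentz (a • P.1 + b • v) P.1 = 0 := by rw [hab]; simp [lorentz]
    have h2 : lorentz (a • P.1 + b • v) v = 0 := by rw [hab]; simp [lorentz]
    rw [lorentz_add_left, lorentz_smul_left, lorentz_smul_left] at h1 h2
    rw [P.2.1, hvP] at h1
    rw [lorentz_comm P.1, hvP, hvv] at h2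
    constructor <;> linarith
  have hspan : Submodule.span ℝ {P.1, v} = V := by
    apply Submodule.eq_of_le_of_finrank_eq
    · rw [Submodule.span_le]
      rintro x (rfl | rfl)
      exacts [hP, hvV]
    · rw [hV, ← Matrix.range_cons_cons_empty P.1 v ![], finrank_span_eq_card hind,
        Fintype.card_fin]
  refine ⟨v, fun X hX => ?_⟩
  have hX : X.1 ∈ V := hX
  rw [← hspan, Submodule.mem_span_pair] at hX
  obtain ⟨a, b, hab⟩ := hX
  have hPX : -lorentz P.1 X.1 = a := by
    rw [← hab, lorentz_add_right, lorentz_smul_right, lorentz_smul_right, P.2.1,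
      lorentz_comm P.1 v, hvP]
    ring
  have ha : 1 ≤ a := hPX ▸ one_le_neg_lorentz P X
  have hsq : a ^ 2 = b ^ 2 + 1 := by
    have h := X.2.1
    rw [← hab] at h
    simp only [lorentz_add_left, lorentz_add_right, lorentz_smul_left, lorentz_smul_right,
      P.2.1, hvv, lorentz_comm P.1 v, hvP] at h
    linarith
  -- The bound `1 ≤ a` selects the branch of the hyperbola `a² = b² + 1`.
  have hcosh : Real.cosh (Real.arsinh b) = a := by
    apply (pow_left_inj₀ (Real.cosh_pos _).le (by linarith) two_ne_zero).1
    rw [Real.cosh_sq, Real.sinh_arsinh, hsq]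
  refine ⟨Real.arsinh b, ?_, ?_⟩
  · rw [hcosh, Real.sinh_arsinh, hab]
  · rw [hdist, hPX, ← hcosh, ← Real.cosh_abs, Real.arcosh_cosh (abs_nonneg _)]

end HypSpace

theorem mainTheorem1 (n : ℕ) (hn : 2 ≤ n) (u : Fin (n + 1) → ℝ) (hu : 0 < lorentz u u)
    (r : ℝ) (hr : 0 < r) (P : HypSpace n) :
    ∃ c : ℝ,
      (∀ (L : Set (HypSpace n)) (A B : HypSpace n), HypSpace.IsLine L → P ∈ L → A ∈ L → B ∈ L →
        A ∈ HypSpace.posBranch u r → B ∈ HypSpace.posBranch u r → A ≠ B →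
        Real.tanh (HypSpace.hdist P A / 2) * Real.tanh (HypSpace.hdist P B / 2) = c) ∧
      (∀ (L : Set (HypSpace n)) (A B : HypSpace n), HypSpace.IsLine L → P ∈ L → A ∈ L → B ∈ L →
        A ∈ HypSpace.posBranch u r → B ∈ HypSpace.negBranch u r → B ≠ P →
        Real.tanh (HypSpace.hdist P A / 2) * hcoth (HypSpace.hdist P B / 2) = c) := by
  set k := √(lorentz u u) * Real.sinh r
  have hk : 0 < k := mul_pos (Real.sqrt_pos.2 hu) (Real.sinh_pos_iff.2 hr)
  have hval {v X : Fin (n + 1) → ℝ} {t : ℝ} (hX : X = Real.cosh t • P.1 + Real.sinh t • v) :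
      lorentz P.1 u * Real.cosh t + lorentz v u * Real.sinh t = lorentz X u := by
    rw [hX, lorentz_add_left, lorentz_smul_left, lorentz_smul_left]; ring
  refine ⟨|lorentz P.1 u - k| / |lorentz P.1 u + k|, ?_, ?_⟩
  · intro L A B hL hP hA hB hAu hBu hAB
    obtain ⟨v, hv⟩ := hL.exists_param hP
    obtain ⟨s, hs, hds⟩ := hv A hA
    obtain ⟨t, ht, hdt⟩ := hv B hB
    rw [hds, hdt]
    refine tanh_half_mul_tanh_half hk
      ((hval hs).trans (HypSpace.lorentz_of_mem_posBranch hu hr hAu))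
      ((hval ht).trans (HypSpace.lorentz_of_mem_posBranch hu hr hBu)) ?_
    rintro rfl
    exact hAB (Subtype.ext (hs.trans ht.symm))
  · intro L A B hL hP hA hB hAu hBu hBP
    obtain ⟨v, hv⟩ := hL.exists_param hP
    obtain ⟨s, hs, hds⟩ := hv A hA
    obtain ⟨t, ht, hdt⟩ := hv B hB
    rw [hds, hdt]
    refine tanh_half_mul_hcoth_half hk
      ((hval hs).trans (HypSpace.lorentz_of_mem_posBranch hu hr hAu))
      ((hval ht).trans (HypSpace.lorentz_of_mem_negBranch hu hr hBu)) ?_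
    rintro rfl
    exact hBP (Subtype.ext (by simpa using ht))
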